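/- Let $\sigma(t)=\max(0,t)$. A ReLU network with $n$ real inputs consists of finitely many hidden layers of units; each unit computes $\sigma$ of an affine function, with real weights, of the inputs and of the values of the units in all earlier layers, and the output is an affine combination of the inputs and of all units (with real coefficients, or with complex ones, i.e. two real outputs, when a complex-valued function is approximated). Its depth is the number of hidden layers and its size is the total number of units (an affine function is a network of depth and size $0$). For $s>1$ and $M\ge 1$ let $$\mathcal E_s^M=\Big\{x+iy\in\mathbb C:\ \frac{x^2}{(M(s+s^{-1})/2)^2}+\frac{y^2}{(M(s-s^{-1})/2)^2}<1\Big\}$$ be the open Bernstein $s$-ellipse scaled to $[-M,M]$. **Theorem (Analytic functions).** There is an absolute constant $K>0$, and for every $s>1$ there are $K_s>0$ and $R_s>0$ depending only on $s$, such that the following holds. Let $0<\epsilon<1$, $M\ge 1$, $C_f>0$, and let $f$ be a real- or complex-valued function on $[-M,M]$ that has an analytic continuation to $\mathcal E_s^M$, bounded there in modulus by $C_f$. Then for every $n\ge 1$ there is a deep ReLU network $\tilde f$ with $n$ inputs (with real output if $f$ is real-valued) such that $$|\tilde f(x,\dots,x)-f(x)|\le\epsilon\qquad\text{for all }x\in[-M,M],$$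 and whose depth $L$ and size $W$ satisfy $$L,\ W\ \le\ K_s\,\frac{\log_2^2(C_f/\epsilon)}{\log_2^2 s},$$ and moreover $L,\ W\le K\,\log_2^2(C_f/\epsilon)/\log_2^2 s$ whenever $C_f/\epsilon\ge R_s$. (In particular, with $n=1$, a network with a single input $x$ approximates $f$ uniformly on $[-M,M]$ to accuracy $\epsilon$.) -/

import Mathlib

/-- The rectified linear unit `σ(t) = max(0, t)`. -/
noncomputable def relu (t : ℝ) : ℝ := max 0 t

/-- A deep ReLU network with `d` real inputs. Its units are arranged in `depth` hidden layers, the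
layer `l` having `width l` units. A unit may receive the inputs of the network and the values of all
units of all earlier layers (connections between non-neighbouring layers are allowed); the output
is an affine combination of the inputs and of all units, with output coefficients in `V`.
For `V = ℝ` this is an ordinary real network; for `V = ℂ` it is a network with two real outputs,
the real and the imaginary part. All weights inside the network are real. -/
structure ReLUNetwork (d : ℕ) (V : Type*) where
  /-- number of hidden layers -/
  depth : ℕ
  /-- number of units of each hidden layer -/
  width : Fin depth → ℕ
  /-- weight with which a unit receives an input -/
  inputWeight : (l : Fin depth) → Fin (width l) → Fin d → ℝ
  /-- weight with which a unit of layer `l` receives a unit of layer `k`; only `k < l` is used -/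
  weight : (l : Fin depth) → Fin (width l) → (k : Fin depth) → Fin (width k) → ℝ
  /-- bias of a unit -/
  bias : (l : Fin depth) → Fin (width l) → ℝ
  /-- coefficient of a unit in the output -/
  outWeight : (l : Fin depth) → Fin (width l) → V
  /-- coefficient of an input in the output -/
  outInput : Fin d → V
  /-- constant term of the output -/
  outBias : V

namespace ReLUNetwork

/-- The size of a network: the total number of units. -/
def size {d : ℕ} {V : Type*} (N : ReLUNetwork d V) : ℕ := ∑ l, N.width l

/-- The value of the unit `i` of the hidden layer `l` on the input `x`. -/
noncomputable def act {d : ℕ} {V : Type*} (N : ReLUNetwork d V) (x : Fin d → ℝ)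
    (l : Fin N.depth) (i : Fin (N.width l)) : ℝ :=
  relu (∑ j, N.inputWeight l i j * x j
    + ∑ k : {k : Fin N.depth // k < l}, ∑ j, N.weight l i k.1 j * N.act x k.1 j
    + N.bias l i)
termination_by l.val
decreasing_by exact k.2

/-- The function computed by a network. -/
noncomputable def eval {d : ℕ} {V : Type*} [AddCommMonoid V] [Module ℝ V]
    (N : ReLUNetwork d V) (x : Fin d → ℝ) : V :=
  ∑ l, ∑ i, N.act x l i • N.outWeight l i + ∑ j, x j • N.outInput j + N.outBias

end ReLUNetwork

/-- The open region bounded by the Bernstein `s`-ellipse scaled to `[-M, M]`, with semi-axes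
`M (s + s⁻¹) / 2` and `M (s - s⁻¹) / 2`. -/
def openBernsteinEllipse (s M : ℝ) : Set ℂ :=
  {z : ℂ | z.re ^ 2 / (M * ((s + s⁻¹) / 2)) ^ 2 + z.im ^ 2 / (M * ((s - s⁻¹) / 2)) ^ 2 < 1}

/-- The restriction of `f` to `[-M, M]` has an analytic continuation to the open Bernstein
`s`-ellipse scaled to `[-M, M]` that is bounded there by `C`. Here `𝕜` is `ℝ` or `ℂ`, and
`RCLike.map 𝕜 ℂ` is its inclusion into `ℂ`. -/
def ContinuableWithBound {𝕜 : Type*} [RCLike 𝕜] (s M C : ℝ) (f : ℝ → 𝕜) : Prop :=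
  ∃ F : ℂ → ℂ, AnalyticOnNhd ℂ F (openBernsteinEllipse s M) ∧
    (∀ x ∈ Set.Icc (-M) M, F (x : ℂ) = RCLike.map 𝕜 ℂ (f x)) ∧
    ∀ z ∈ openBernsteinEllipse s M, ‖F z‖ ≤ C

/-!
The function is expanded in Chebyshev polynomials, the series is truncated, and the resulting
polynomial is evaluated by ReLU units with approximate multiplications. Write `m` for the degree,
which is of order `log (C / ε) / log s`; at most a constant times `m ^ 2` units are allowed.

**The number of multiplications.** By Yarotsky's construction (`ReLUSpan.exists_approx_mul`) a
product with error of order `4 ^ (-r)` takes `4 * r` units, and `r` has to be of order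
`log (C / ε) + m ≈ m * (log s + 1)`. One multiplication per degree would give `m ^ 2 * (log s + 1)`
units, so for large `s` the constant would not be absolute. The Paterson-Stockmeyer scheme
(`ReLUSpan.exists_approx_polynomial`) needs only about `2 * √m` multiplications, hence
`m ^ (3 / 2) * (log s + 1)` units, which is at most `m ^ 2` once `m` is large in terms of `s`. This
leaves room for the exponential growth of the monomial coefficients of Chebyshev polynomials
(`sum_abs_coeff_T_le`). Affine combinations cost nothing, and all networks have layers of width one,
so that depth and size agree (`ReLUSpan`, `ReLUSpan.exists_network`).

**The expansion.** On the unit circle `F ((w + w⁻¹) / 2)` becomes `F (cos θ)`. It is analytic on the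
annulus `s⁻¹ < |w| < s`, so moving the contour to the radius `√s` shows that its Fourier
coefficients decay like `√s ^ (-|n|)` (`exists_chebyshev_expansion`). The loss of a factor two
against the optimal rate only affects the absolute constant.

**All accuracies.** If `C / ε` lies below the threshold, but above some constant `(1 - η)⁻¹ > 1`
depending on `s`, the network for the accuracy at the threshold will do, since `log (C / ε)` is
bounded away from zero. If `C / ε` is even smaller, the bound may allow no units at all, and a
constant is required. It exists because an analytic function whose modulus nearly attains its
bound `C` at a point of `[-M, M]` is nearly constant there (`exists_const_approx`).
-/

/-! ### Spans of ReLU units -/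

/-- `ReLUSpan n V` says that `V` is the space of all functions of one real variable that are affine
combinations of the input and of `n` units, which are computed one after another. Each new unit
may use all the units before it, so this is a network with `n` layers of width one; depth and size
are both `n`. Working with the whole span makes affine combinations free of charge. -/
inductive ReLUSpan : ℕ → Submodule ℝ (ℝ → ℝ) → Prop
  | zero : ReLUSpan 0 (Submodule.span ℝ {1, id})
  | succ {n : ℕ} {V : Submodule ℝ (ℝ → ℝ)} {u : ℝ → ℝ} : ReLUSpan n V → u ∈ V →
      ReLUSpan (n + 1) (V ⊔ Submodule.span ℝ {fun x => relu (u x)})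

namespace ReLUSpan

variable {n : ℕ} {V : Submodule ℝ (ℝ → ℝ)}

theorem one_id_mem (h : ReLUSpan n V) : (1 : ℝ → ℝ) ∈ V ∧ (id : ℝ → ℝ) ∈ V := by
  induction h with
  | zero => exact ⟨Submodule.subset_span (by simp), Submodule.subset_span (by simp)⟩
  | succ _ _ ih => exact ⟨le_sup_left (α := Submodule ℝ (ℝ → ℝ)) ih.1,
      le_sup_left (α := Submodule ℝ (ℝ → ℝ)) ih.2⟩

theorem const_mem (h : ReLUSpan n V) (c : ℝ) : (fun _ => c) ∈ V := by
  have := V.smul_mem c h.one_id_mem.1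
  convert this using 1
  ext x
  simp

theorem add_relu (h : ReLUSpan n V) {u : ℝ → ℝ} (hu : u ∈ V) :
    ∃ V', ReLUSpan (n + 1) V' ∧ V ≤ V' ∧ (fun x => relu (u x)) ∈ V' :=
  ⟨_, h.succ hu, le_sup_left,
    le_sup_right (α := Submodule ℝ (ℝ → ℝ)) (Submodule.mem_span_singleton_self _)⟩

theorem sup {m : ℕ} {W : Submodule ℝ (ℝ → ℝ)} (hV : ReLUSpan n V) (hW : ReLUSpan m W) :
    ReLUSpan (n + m) (V ⊔ W) := by
  induction hW with
  | zero =>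
    have : V ⊔ Submodule.span ℝ {1, id} = V := sup_eq_left.2 <| Submodule.span_le.2 <| by
      rintro f (rfl | rfl)
      exacts [hV.one_id_mem.1, hV.one_id_mem.2]
    rwa [this]
  | succ h hu ih =>
    rw [← sup_assoc]
    exact ih.succ (le_sup_right (α := Submodule ℝ (ℝ → ℝ)) hu)

/-- The weights of the units behind a span. -/
theorem exists_units (h : ReLUSpan n V) : ∃ v : ℕ → ℝ → ℝ,
    (∀ k < n, ∃ (a b : ℝ) (w : ℕ → ℝ), ∀ x,
      v k x = relu (a * x + ∑ j ∈ Finset.range k, w j * v j x + b)) ∧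
    ∀ g ∈ V, ∃ (a b : ℝ) (w : ℕ → ℝ), ∀ x,
      g x = ∑ j ∈ Finset.range n, w j * v j x + a * x + b := by
  induction h with
  | zero =>
    refine ⟨0, by simp, fun g hg => ?_⟩
    obtain ⟨b, a, rfl⟩ := Submodule.mem_span_pair.1 hg
    exact ⟨a, b, 0, fun x => by simp [add_comm]⟩
  | @succ n V u h hu ih =>
    obtain ⟨v, hv, hV⟩ := ih
    have key : ∀ k ≤ n, ∀ (w : ℕ → ℝ) (x : ℝ),
        ∑ j ∈ Finset.range k, w j * Function.update v n (fun x => relu (u x)) j x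
          = ∑ j ∈ Finset.range k, w j * v j x := by
      intro k hk w x
      refine Finset.sum_congr rfl fun j hj => ?_
      have : j ≠ n := by have := Finset.mem_range.1 hj; omega
      simp [this]
    refine ⟨Function.update v n (fun x => relu (u x)), fun k hk => ?_, fun g hg => ?_⟩
    · rcases Nat.lt_succ_iff_lt_or_eq.1 hk with hk | rfl
      · obtain ⟨a, b, w, e⟩ := hv k hk
        refine ⟨a, b, w, fun x => ?_⟩
        rw [key k hk.le, Function.update_of_ne hk.ne, e]
      · obtain ⟨a, b, w, e⟩ := hV u hu
        refine ⟨a, b, w, fun x => ?_⟩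
        rw [key k le_rfl, Function.update_self, e]
        congr 1
        ring
    · obtain ⟨g₁, hg₁, g₂, hg₂, rfl⟩ := Submodule.mem_sup.1 hg
      obtain ⟨c, rfl⟩ := Submodule.mem_span_singleton.1 hg₂
      obtain ⟨a, b, w, e⟩ := hV g₁ hg₁
      refine ⟨a, b, Function.update w n c, fun x => ?_⟩
      have : ∑ j ∈ Finset.range n, Function.update w n c j *
          Function.update v n (fun x => relu (u x)) j x = ∑ j ∈ Finset.range n, w j * v j x := by
        rw [key n le_rfl]
        refine Finset.sum_congr rfl fun j hj => ?_
        have : j ≠ n := by have := Finset.mem_range.1 hj; omega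
        simp [this]
      rw [Finset.sum_range_succ, this]
      simp [e x]
      ring

/-- Two functions in the span of `n` units, taken as real and imaginary part, are computed by a
network with `n` layers of width one. The network sees `d` copies of `x` and uses
the first one, divided by `M`. -/
theorem exists_network (h : ReLUSpan n V) {𝕜 : Type} [RCLike 𝕜] {d : ℕ} (hd : 1 ≤ d) (M : ℝ)
    {g₁ g₂ : ℝ → ℝ} (h₁ : g₁ ∈ V) (h₂ : g₂ ∈ V) : ∃ N : ReLUNetwork d 𝕜,
      N.depth = n ∧ N.size = n ∧
      ∀ x, N.eval (fun _ => x) = (g₁ (x / M) : 𝕜) + (g₂ (x / M) : 𝕜) * RCLike.I := by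
  obtain ⟨v, hv, hV⟩ := h.exists_units
  obtain ⟨a₁, b₁, w₁, e₁⟩ := hV g₁ h₁
  obtain ⟨a₂, b₂, w₂, e₂⟩ := hV g₂ h₂
  have hv' : ∀ k : Fin n, ∃ (a b : ℝ) (w : ℕ → ℝ), ∀ x,
      v k x = relu (a * x + ∑ j ∈ Finset.range k, w j * v j x + b) := fun k => hv k k.2
  choose a b w e using hv'
  let z : Fin d := ⟨0, hd⟩
  let N : ReLUNetwork d 𝕜 :=
    { depth := n
      width := fun _ => 1
      inputWeight := fun l _ j => if j = z then a l / M else 0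
      weight := fun l _ k _ => w l k
      bias := fun l _ => b l
      outWeight := fun l _ => (w₁ l : 𝕜) + (w₂ l : 𝕜) * RCLike.I
      outInput := fun j => if j = z then ((a₁ / M : ℝ) : 𝕜) + ((a₂ / M : ℝ) : 𝕜) * RCLike.I else 0
      outBias := (b₁ : 𝕜) + (b₂ : 𝕜) * RCLike.I }
  have hact : ∀ (m : ℕ) (l : Fin n) (i : Fin 1) (x : ℝ), l.val = m →
      N.act (fun _ => x) l i = v l (x / M) := by
    intro m
    induction m using Nat.strong_induction_on with
    | _ m ih =>
      intro l i x hl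
      rw [ReLUNetwork.act, e]
      congr 2
      congr 1
      · simp [N]
        ring
      · have h1 : ∀ k : {k : Fin n // k < l},
            (∑ j, N.weight l i k.1 j * N.act (fun _ => x) k.1 j)
              = w l k.1 * v k.1 (x / M) := by
          intro k
          have hk : (k.1 : ℕ) < m := by rw [← hl]; exact k.2
          have : ∀ j : Fin (N.width k.1), N.weight l i k.1 j * N.act (fun _ => x) k.1 j
              = w l k.1 * v k.1 (x / M) := fun j => by rw [ih _ hk k.1 j x rfl]
          rw [Finset.sum_congr rfl fun j _ => this j]
          simp [N]
        refine (Finset.sum_congr rfl fun k _ => h1 k).trans ?_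
        refine Finset.sum_bij' (fun k _ => (k.1 : ℕ))
          (fun j hj => ⟨⟨j, (Finset.mem_range.1 hj).trans l.2⟩,
            Fin.lt_def.2 (Finset.mem_range.1 hj)⟩) ?_ ?_ ?_ ?_ ?_
        · intro k _
          exact Finset.mem_range.2 k.2
        · intro j hj
          exact Finset.mem_univ _
        · intro k _
          rfl
        · intro j hj
          rfl
        · intro k _
          rfl
  refine ⟨N, rfl, by simp [ReLUNetwork.size, N], fun x => ?_⟩
  have h1 : ∀ l : Fin n, ∑ i, N.act (fun _ => x) l i • N.outWeight l i
      = ((w₁ l * v l (x / M) : ℝ) : 𝕜) + ((w₂ l * v l (x / M) : ℝ) : 𝕜) * RCLike.I := by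
    intro l
    have : ∀ i : Fin (N.width l), N.act (fun _ => x) l i • N.outWeight l i
        = ((w₁ l * v l (x / M) : ℝ) : 𝕜) + ((w₂ l * v l (x / M) : ℝ) : 𝕜) * RCLike.I := by
      intro i
      rw [hact _ l i x rfl]
      simp only [N, RCLike.real_smul_eq_coe_mul]
      push_cast
      ring
    rw [Finset.sum_congr rfl fun i _ => this i]
    simp [N]
  have h2 : ∑ j, x • N.outInput j
      = ((a₁ * (x / M) : ℝ) : 𝕜) + ((a₂ * (x / M) : ℝ) : 𝕜) * RCLike.I := by
    simp [N, RCLike.real_smul_eq_coe_mul]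
    ring
  have h3 : ∑ l : Fin n, (((w₁ l * v l (x / M) : ℝ) : 𝕜)
        + ((w₂ l * v l (x / M) : ℝ) : 𝕜) * RCLike.I)
      = ((∑ j ∈ Finset.range n, w₁ j * v j (x / M) : ℝ) : 𝕜)
        + ((∑ j ∈ Finset.range n, w₂ j * v j (x / M) : ℝ) : 𝕜) * RCLike.I := by
    rw [Finset.sum_add_distrib, ← Finset.sum_mul, ← RCLike.ofReal_sum, ← RCLike.ofReal_sum,
      Fin.sum_univ_eq_sum_range (fun j => w₁ j * v j (x / M)),
      Fin.sum_univ_eq_sum_range (fun j => w₂ j * v j (x / M))]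
  rw [ReLUNetwork.eval, Finset.sum_congr rfl fun l _ => h1 l, h2]
  erw [h3]
  rw [e₁, e₂]
  simp only [N]
  push_cast
  ring

/-! ### Approximate multiplication -/

/-- The values of `u` are squared by iterating the tent map `t`, which satisfies
`x - x ^ 2 = t x / 4 + (t x - t x ^ 2) / 4` on `[0, 1]`: each iteration costs two units and
divides the error by four. -/
theorem exists_approx_sq {D : Set ℝ} (r : ℕ) : ∀ {n : ℕ} {V : Submodule ℝ (ℝ → ℝ)},
    ReLUSpan n V → ∀ {u : ℝ → ℝ}, u ∈ V → (∀ x ∈ D, u x ∈ Set.Icc 0 1) →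
    ∃ V', ReLUSpan (n + 2 * r) V' ∧ V ≤ V' ∧
      ∃ p ∈ V', ∀ x ∈ D, |p x - u x ^ 2| ≤ 1 / 4 ^ (r + 1) := by
  induction r with
  | zero =>
    intro n V h u hu hD
    refine ⟨V, h, le_rfl, u, hu, fun x hx => ?_⟩
    obtain ⟨h0, h1⟩ := hD x hx
    rw [abs_le]
    constructor <;> nlinarith [sq_nonneg (u x - 1 / 2)]
  | succ r ih =>
    intro n V h u hu hD
    obtain ⟨V₁, hV₁, hle₁, hm₁⟩ := h.add_relu hu
    have hu' : (fun x => u x - 1 / 2) ∈ V₁ := V₁.sub_mem (hle₁ hu) (hV₁.const_mem _)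
    obtain ⟨V₂, hV₂, hle₂, hm₂⟩ := hV₁.add_relu hu'
    have ht : (fun x => 2 * relu (u x) - 4 * relu (u x - 1 / 2)) ∈ V₂ :=
      V₂.sub_mem (V₂.smul_mem 2 (hle₂ hm₁)) (V₂.smul_mem 4 hm₂)
    have htv : ∀ x ∈ D, (2 * relu (u x) - 4 * relu (u x - 1 / 2) = 2 * u x ∧ u x ≤ 1 / 2) ∨
        (2 * relu (u x) - 4 * relu (u x - 1 / 2) = 2 - 2 * u x ∧ 1 / 2 ≤ u x) := by
      intro x hx
      obtain ⟨h0, h1⟩ := hD x hx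
      rcases le_total (u x) (1 / 2) with h | h
      · refine Or.inl ⟨?_, h⟩
        rw [relu, relu, max_eq_right h0, max_eq_left (by linarith)]
        ring
      · refine Or.inr ⟨?_, h⟩
        rw [relu, relu, max_eq_right h0, max_eq_right (by linarith)]
        ring
    obtain ⟨V₃, hV₃, hle₃, p, hp, hpe⟩ := ih hV₂ ht (fun x hx => by
      obtain ⟨h0, h1⟩ := hD x hx
      rcases htv x hx with ⟨e, h⟩ | ⟨e, h⟩ <;>
      · show _ ∈ Set.Icc (0 : ℝ) 1
        rw [e]
        constructor <;> linarith)
    refine ⟨V₃, ?_, hle₁.trans (hle₂.trans hle₃),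
      fun x => u x - (1 / 2) * (2 * relu (u x) - 4 * relu (u x - 1 / 2)) + (1 / 4) * p x,
      V₃.add_mem (V₃.sub_mem (hle₃ (hle₂ (hle₁ hu))) (V₃.smul_mem (1 / 2) (hle₃ ht)))
        (V₃.smul_mem (1 / 4) hp), fun x hx => ?_⟩
    · convert hV₃ using 1
      ring
    · have := hpe x hx
      set t := 2 * relu (u x) - 4 * relu (u x - 1 / 2)
      have e : u x - (1 / 2) * t + (1 / 4) * p x - u x ^ 2 = (p x - t ^ 2) / 4 := by
        rcases htv x hx with ⟨e, h⟩ | ⟨e, h⟩ <;>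
        · rw [show t = _ from e]
          ring
      have e4 : (1 : ℝ) / 4 ^ (r + 1 + 1) = 1 / 4 ^ (r + 1) / 4 := by
        rw [pow_succ _ (r + 1), div_div]
      rw [e, abs_div, abs_of_pos (by norm_num : (0 : ℝ) < 4), e4]
      linarith

/-- Polarization reduces a product to two squares of functions with values in `[0, 1]`. -/
theorem exists_approx_mul {D : Set ℝ} (h : ReLUSpan n V) (r : ℕ) {u v : ℝ → ℝ}
    (hu : u ∈ V) (hv : v ∈ V) (hu2 : ∀ x ∈ D, |u x| ≤ 2) (hv2 : ∀ x ∈ D, |v x| ≤ 2) :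
    ∃ V', ReLUSpan (n + 4 * r) V' ∧ V ≤ V' ∧
      ∃ p ∈ V', ∀ x ∈ D, |p x - u x * v x| ≤ 8 / 4 ^ r := by
  have ha : (fun x => (1 / 8) * (u x + v x + 4)) ∈ V :=
    V.smul_mem (1 / 8) (V.add_mem (V.add_mem hu hv) (h.const_mem 4))
  have hb : (fun x => (1 / 8) * (u x - v x + 4)) ∈ V :=
    V.smul_mem (1 / 8) (V.add_mem (V.sub_mem hu hv) (h.const_mem 4))
  obtain ⟨V₁, hV₁, hle₁, p, hp, hpe⟩ := exists_approx_sq (D := D) r h ha (fun x hx => by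
    have := abs_le.1 (hu2 x hx)
    have := abs_le.1 (hv2 x hx)
    constructor <;> linarith)
  obtain ⟨V₂, hV₂, hle₂, q, hq, hqe⟩ := exists_approx_sq (D := D) r hV₁ (hle₁ hb) (fun x hx => by
    have := abs_le.1 (hu2 x hx)
    have := abs_le.1 (hv2 x hx)
    constructor <;> linarith)
  refine ⟨V₂, ?_, hle₁.trans hle₂, fun x => 16 * (p x - q x) - 4 * v x,
    V₂.sub_mem (V₂.smul_mem 16 (V₂.sub_mem (hle₂ hp) hq))
      (V₂.smul_mem 4 (hle₂ (hle₁ hv))), fun x hx => ?_⟩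
  · convert hV₂ using 1
    ring
  · have h1 := abs_le.1 (hpe x hx)
    have h2 := abs_le.1 (hqe x hx)
    have e : (8 : ℝ) / 4 ^ r = 32 * (1 / 4 ^ (r + 1)) := by
      rw [pow_succ]
      field_simp
      norm_num
    rw [e, abs_le]
    constructor <;> nlinarith

/-! ### Polynomials with few multiplications -/

theorem exists_approx_powers (r q : ℕ) (hq : q * (8 / 4 ^ r : ℝ) ≤ 1) :
    ∃ V, ReLUSpan (4 * r * q) V ∧ ∃ P : ℕ → ℝ → ℝ, ∀ i ≤ q, P i ∈ V ∧
      ∀ x ∈ Set.Icc (-1 : ℝ) 1, |P i x - x ^ i| ≤ i * (8 / 4 ^ r) := by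
  induction q with
  | zero =>
    refine ⟨_, ReLUSpan.zero, fun _ => 1, fun i hi => ?_⟩
    obtain rfl : i = 0 := by omega
    exact ⟨ReLUSpan.zero.one_id_mem.1, by simp⟩
  | succ q ih =>
    have hδ : (0 : ℝ) ≤ 8 / 4 ^ r := by positivity
    set δ : ℝ := 8 / 4 ^ r with hδ'
    push_cast at hq
    obtain ⟨V, hV, P, hP⟩ := ih (by linarith)
    have hpow : ∀ x ∈ Set.Icc (-1 : ℝ) 1, ∀ k : ℕ, |x ^ k| ≤ 1 := fun x hx k => by
      rw [abs_pow]
      exact pow_le_one₀ (abs_nonneg _) (abs_le.2 hx)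
    obtain ⟨V', hV', hle, p, hp, hpe⟩ := hV.exists_approx_mul (D := Set.Icc (-1) 1) r
      (hP q le_rfl).1 hV.one_id_mem.2 (fun x hx => by
        have h1 := abs_le.1 ((hP q le_rfl).2 x hx)
        have h2 := abs_le.1 (hpow x hx q)
        rw [abs_le]
        constructor <;> linarith) (fun x hx => by
        have := abs_le.2 hx
        simp only [id]
        linarith)
    refine ⟨V', by convert hV' using 1; ring, Function.update P (q + 1) p, fun i hi => ?_⟩
    rcases Nat.le_succ_iff.1 hi with hi | rfl
    · have : i ≠ q + 1 := by omega
      simp only [Function.update_of_ne this]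
      exact ⟨hle (hP i hi).1, (hP i hi).2⟩
    · simp only [Function.update_self]
      refine ⟨hp, fun x hx => ?_⟩
      have h1 := hpe x hx
      have h2 := (hP q le_rfl).2 x hx
      have h3 : |(P q x - x ^ q) * x| ≤ q * δ := by
        rw [abs_mul]
        exact (mul_le_of_le_one_right (abs_nonneg _) (abs_le.2 hx)).trans h2
      calc |p x - x ^ (q + 1)| = |(p x - P q x * id x) + (P q x - x ^ q) * x| := by
            congr 1
            simp only [id]
            ring
        _ ≤ δ + q * δ := (abs_add_le _ _).trans (add_le_add h1 h3)
        _ = ((q + 1 : ℕ) : ℝ) * δ := by push_cast; ring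

/-- Horner's scheme in `x ^ q`, with coefficients that are combinations of the lower
powers of `x`, which are already available. -/
theorem exists_approx_horner {r q : ℕ} (hq1 : 1 ≤ q) (hq : 4 * q ^ 2 * (8 / 4 ^ r : ℝ) ≤ 1)
    (h : ReLUSpan n V) {P : ℕ → ℝ → ℝ} (hP : ∀ i ≤ q, P i ∈ V ∧
      ∀ x ∈ Set.Icc (-1 : ℝ) 1, |P i x - x ^ i| ≤ i * (8 / 4 ^ r)) (k : ℕ) (hk : k ≤ q) :
    ∀ c : ℕ → ℕ → ℝ, ∑ j ∈ Finset.range k, ∑ i ∈ Finset.range q, |c j i| ≤ 1 →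
    ∃ V', ReLUSpan (n + 4 * r * k) V' ∧ V ≤ V' ∧ ∃ g ∈ V', ∀ x ∈ Set.Icc (-1 : ℝ) 1,
      |g x - ∑ j ∈ Finset.range k, (x ^ q) ^ j * ∑ i ∈ Finset.range q, c j i * x ^ i|
        ≤ k * (4 * q * (8 / 4 ^ r)) := by
  have hδ : (0 : ℝ) ≤ 8 / 4 ^ r := by positivity
  set δ : ℝ := 8 / 4 ^ r with hδ'
  have hq1' : (1 : ℝ) ≤ q := by exact_mod_cast hq1
  have hqδ : (q : ℝ) * δ ≤ 1 := by nlinarith [mul_nonneg (by linarith : (0:ℝ) ≤ q) hδ]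
  have hpow : ∀ x ∈ Set.Icc (-1 : ℝ) 1, ∀ k : ℕ, |x ^ k| ≤ 1 := fun x hx k => by
    rw [abs_pow]
    exact pow_le_one₀ (abs_nonneg _) (abs_le.2 hx)
  have hrow : ∀ x ∈ Set.Icc (-1 : ℝ) 1, ∀ d : ℕ → ℝ,
      |∑ i ∈ Finset.range q, d i * x ^ i| ≤ ∑ i ∈ Finset.range q, |d i| := fun x hx d => by
    refine (Finset.abs_sum_le_sum_abs _ _).trans (Finset.sum_le_sum fun i _ => ?_)
    rw [abs_mul]
    exact mul_le_of_le_one_right (abs_nonneg _) (hpow x hx i)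
  induction k with
  | zero =>
    intro c _
    exact ⟨V, by simpa using h, le_rfl, 0, V.zero_mem, by simp⟩
  | succ k ih =>
    intro c hc
    rw [Finset.sum_range_succ'] at hc
    have hc0 : 0 ≤ ∑ i ∈ Finset.range q, |c 0 i| := Finset.sum_nonneg fun _ _ => abs_nonneg _
    have hc1 : 0 ≤ ∑ j ∈ Finset.range k, ∑ i ∈ Finset.range q, |c (j + 1) i| :=
      Finset.sum_nonneg fun _ _ => Finset.sum_nonneg fun _ _ => abs_nonneg _
    obtain ⟨V₁, hV₁, hle₁, g, hg, hge⟩ := ih (by omega) (fun j => c (j + 1)) (by linarith)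
    set H : ℝ → ℝ := fun x =>
      ∑ j ∈ Finset.range k, (x ^ q) ^ j * ∑ i ∈ Finset.range q, c (j + 1) i * x ^ i with hH
    have hH1 : ∀ x ∈ Set.Icc (-1 : ℝ) 1, |H x| ≤ 1 := fun x hx => by
      refine (Finset.abs_sum_le_sum_abs _ _).trans
        ((Finset.sum_le_sum fun j _ => ?_).trans (by linarith : ∑ j ∈ Finset.range k,
          ∑ i ∈ Finset.range q, |c (j + 1) i| ≤ 1))
      rw [abs_mul, ← pow_mul]
      exact (mul_le_of_le_one_left (abs_nonneg _) (hpow x hx _)).trans (hrow x hx _)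
    have hkE : (k : ℝ) * (4 * q * δ) ≤ 1 := by
      have : (k : ℝ) ≤ q := by exact_mod_cast (by omega : k ≤ q)
      have h4 : 0 ≤ 4 * q * δ := by positivity
      nlinarith [mul_le_mul_of_nonneg_right this h4]
    have hg2 : ∀ x ∈ Set.Icc (-1 : ℝ) 1, |g x| ≤ 2 := fun x hx => by
      have h1 := abs_le.1 (hge x hx)
      have h2 := abs_le.1 (hH1 x hx)
      rw [abs_le]
      constructor <;> linarith
    obtain ⟨V₂, hV₂, hle₂, p, hp, hpe⟩ := hV₁.exists_approx_mul (D := Set.Icc (-1) 1) r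
      (hle₁ (hP q le_rfl).1) hg (fun x hx => by
        have h1 := abs_le.1 ((hP q le_rfl).2 x hx)
        have h2 := abs_le.1 (hpow x hx q)
        rw [abs_le]
        constructor <;> linarith) hg2
    refine ⟨V₂, ?_, hle₁.trans hle₂, fun x => (∑ i ∈ Finset.range q, c 0 i • P i : ℝ → ℝ) x + p x, ?_,
      fun x hx => ?_⟩
    · convert hV₂ using 1
      ring
    · refine V₂.add_mem (V₂.sum_mem fun i hi => V₂.smul_mem _ ?_) hp
      exact hle₂ (hle₁ (hP i (Finset.mem_range.1 hi).le).1)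
    · have e1 : |∑ i ∈ Finset.range q, c 0 i * (P i x - x ^ i)| ≤ q * δ := by
        calc |∑ i ∈ Finset.range q, c 0 i * (P i x - x ^ i)|
            ≤ ∑ i ∈ Finset.range q, |c 0 i| * (q * δ) := by
              refine (Finset.abs_sum_le_sum_abs _ _).trans (Finset.sum_le_sum fun i hi => ?_)
              rw [abs_mul]
              refine mul_le_mul_of_nonneg_left ?_ (abs_nonneg _)
              have hi' := (Finset.mem_range.1 hi).le
              refine ((hP i hi').2 x hx).trans (mul_le_mul_of_nonneg_right ?_ hδ)
              exact_mod_cast hi'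
          _ ≤ q * δ := by
              rw [← Finset.sum_mul]
              exact mul_le_of_le_one_left (by positivity) (by linarith)
      have e2 := hpe x hx
      have e3 : |(P q x - x ^ q) * g x| ≤ q * δ * 2 := by
        rw [abs_mul]
        exact mul_le_mul ((hP q le_rfl).2 x hx) (hg2 x hx) (abs_nonneg _) (by positivity)
      have e4 : |x ^ q * (g x - H x)| ≤ k * (4 * q * δ) := by
        rw [abs_mul]
        exact (mul_le_of_le_one_left (abs_nonneg _) (hpow x hx q)).trans (hge x hx)
      have e5 : ∑ j ∈ Finset.range (k + 1), (x ^ q) ^ j * ∑ i ∈ Finset.range q, c j i * x ^ i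
          = x ^ q * H x + ∑ i ∈ Finset.range q, c 0 i * x ^ i := by
        rw [Finset.sum_range_succ', hH]
        simp only [pow_zero, one_mul, pow_succ', mul_assoc, ← Finset.mul_sum]
      rw [e5]
      have e6 : ((∑ i ∈ Finset.range q, c 0 i • P i : ℝ → ℝ) x + p x)
            - (x ^ q * H x + ∑ i ∈ Finset.range q, c 0 i * x ^ i)
          = ∑ i ∈ Finset.range q, c 0 i * (P i x - x ^ i) + (p x - P q x * g x)
            + (P q x - x ^ q) * g x + x ^ q * (g x - H x) := by
        simp only [Finset.sum_apply, Pi.smul_apply, smul_eq_mul, mul_sub, Finset.sum_sub_distrib]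
        ring
      rw [e6, abs_le]
      rw [abs_le] at e1 e2 e3 e4
      push_cast
      constructor <;> nlinarith

theorem sum_range_mul_eq (f : ℕ → ℝ) (q k : ℕ) :
    ∑ m ∈ Finset.range (k * q), f m
      = ∑ j ∈ Finset.range k, ∑ i ∈ Finset.range q, f (j * q + i) := by
  induction k with
  | zero => simp
  | succ k ih => rw [Nat.succ_mul, Finset.sum_range_add, ih, Finset.sum_range_succ]

/-- The Paterson-Stockmeyer scheme: a polynomial with `q ^ 2` coefficients is evaluated with
`2 * q` multiplications only. -/
theorem exists_approx_polynomial {r q : ℕ} (hq1 : 1 ≤ q) (hq : 4 * q ^ 2 * (8 / 4 ^ r : ℝ) ≤ 1)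
    (d : ℕ → ℝ) {A : ℝ} (hA : 0 < A) (hd : ∑ m ∈ Finset.range (q * q), |d m| ≤ A) :
    ∃ V, ReLUSpan (8 * r * q) V ∧ ∃ g ∈ V, ∀ x ∈ Set.Icc (-1 : ℝ) 1,
      |g x - ∑ m ∈ Finset.range (q * q), d m * x ^ m| ≤ A * (4 * q ^ 2 * (8 / 4 ^ r)) := by
  have hδ : (0 : ℝ) ≤ 8 / 4 ^ r := by positivity
  have hq1' : (1 : ℝ) ≤ q := by exact_mod_cast hq1
  obtain ⟨V, hV, P, hP⟩ := exists_approx_powers r q (by nlinarith)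
  obtain ⟨V', hV', -, g, hg, hge⟩ := exists_approx_horner hq1 hq hV hP q le_rfl
    (fun j i => d (j * q + i) / A) (by
      rw [← sum_range_mul_eq (fun m => |d m / A|)]
      simp_rw [abs_div, abs_of_pos hA, ← Finset.sum_div]
      exact (div_le_one hA).2 hd)
  refine ⟨V', ?_, A • g, V'.smul_mem A hg, fun x hx => ?_⟩
  · convert hV' using 1
    ring
  · have e : ∑ m ∈ Finset.range (q * q), d m * x ^ m = A * ∑ j ∈ Finset.range q,
        (x ^ q) ^ j * ∑ i ∈ Finset.range q, d (j * q + i) / A * x ^ i := by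
      rw [sum_range_mul_eq (fun m => d m * x ^ m), Finset.mul_sum]
      refine Finset.sum_congr rfl fun j _ => ?_
      rw [Finset.mul_sum, Finset.mul_sum]
      refine Finset.sum_congr rfl fun i _ => ?_
      rw [pow_add, mul_comm j q, pow_mul]
      field_simp
    rw [e, Pi.smul_apply, smul_eq_mul, ← mul_sub, abs_mul, abs_of_pos hA]
    refine mul_le_mul_of_nonneg_left ((hge x hx).trans_eq ?_) hA.le
    ring

end ReLUSpan

/-! ### Chebyshev expansion on a Bernstein ellipse -/

theorem isOpen_openBernsteinEllipse (s M : ℝ) : IsOpen (openBernsteinEllipse s M) :=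
  isOpen_lt (by fun_prop) continuous_const

theorem ofReal_mem_openBernsteinEllipse {s x : ℝ} (hs : 1 < s) (hx : x ∈ Set.Icc (-1 : ℝ) 1) :
    (x : ℂ) ∈ openBernsteinEllipse s 1 := by
  have hs0 : 0 < s := by linarith
  have h1 : 1 < (s + s⁻¹) / 2 := by
    have : s * s⁻¹ = 1 := mul_inv_cancel₀ hs0.ne'
    nlinarith [mul_pos (sub_pos.2 hs) (sub_pos.2 hs), inv_pos.2 hs0]
  have h2 : x ^ 2 ≤ 1 := by nlinarith [hx.1, hx.2]
  simp only [openBernsteinEllipse, Set.mem_ofPred_eq, Complex.ofReal_re, Complex.ofReal_im, one_mul]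
  rw [zero_pow two_ne_zero, zero_div, add_zero, div_lt_one (by positivity)]
  nlinarith

/-- The Joukowski map sends the annulus `s⁻¹ < |w| < s` into the ellipse. -/
theorem joukowski_mem {s : ℝ} (hs : 1 < s) {w : ℂ} (h1 : s⁻¹ < ‖w‖) (h2 : ‖w‖ < s) :
    (w + w⁻¹) / 2 ∈ openBernsteinEllipse s 1 := by
  have hs0 : 0 < s := by linarith
  have hw : 0 < ‖w‖ := (inv_pos.2 hs0).trans h1
  obtain ⟨N, hN⟩ : ∃ N, N = Complex.normSq w := ⟨_, rfl⟩
  have hNe : N = ‖w‖ ^ 2 := by rw [hN, Complex.sq_norm]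
  have hN0 : 0 < N := by rw [hNe]; positivity
  have hab : w.re ^ 2 + w.im ^ 2 = N := by rw [hN, Complex.normSq_apply]; ring
  have hre : ((w + w⁻¹) / 2).re = w.re * (1 + N⁻¹) / 2 := by
    simp [Complex.inv_re, ← hN]
    ring
  have him : ((w + w⁻¹) / 2).im = w.im * (1 - N⁻¹) / 2 := by
    simp [Complex.inv_im, ← hN]
    ring
  have hsum : N + N⁻¹ < s ^ 2 + (s⁻¹) ^ 2 := by
    have hNs : N < s ^ 2 := by rw [hNe]; gcongr
    have hNs' : (s⁻¹) ^ 2 < N := by rw [hNe]; gcongr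
    have e : s ^ 2 + (s⁻¹) ^ 2 - (N + N⁻¹) = (s ^ 2 - N) * (N - (s⁻¹) ^ 2) * N⁻¹ := by
      field_simp
      ring
    have : 0 < (s ^ 2 - N) * (N - (s⁻¹) ^ 2) * N⁻¹ :=
      mul_pos (mul_pos (sub_pos.2 hNs) (sub_pos.2 hNs')) (inv_pos.2 hN0)
    linarith
  have hss : s * s⁻¹ = 1 := mul_inv_cancel₀ hs0.ne'
  have hNN : N * N⁻¹ = 1 := mul_inv_cancel₀ hN0.ne'
  have hA : 0 < s + s⁻¹ := by positivity
  have hB : 0 < s - s⁻¹ := by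
    have : s⁻¹ < 1 := inv_lt_one_of_one_lt₀ hs
    linarith
  have hx : (w.re * (1 + N⁻¹) / 2) ^ 2 / (1 * ((s + s⁻¹) / 2)) ^ 2
      = w.re ^ 2 / N * ((N + N⁻¹ + 2) / (s + s⁻¹) ^ 2) := by
    field_simp
    ring
  have hy : (w.im * (1 - N⁻¹) / 2) ^ 2 / (1 * ((s - s⁻¹) / 2)) ^ 2
      = w.im ^ 2 / N * ((N + N⁻¹ - 2) / (s - s⁻¹) ^ 2) := by
    have e : N + N⁻¹ - 2 = N * (1 - N⁻¹) ^ 2 := by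
      field_simp
      ring
    rw [e]
    generalize 1 - N⁻¹ = t
    generalize s - s⁻¹ = b at hB
    field_simp
  have hx1 : (N + N⁻¹ + 2) / (s + s⁻¹) ^ 2 < 1 := by
    rw [div_lt_one (by positivity)]
    nlinarith
  have hy1 : (N + N⁻¹ - 2) / (s - s⁻¹) ^ 2 < 1 := by
    rw [div_lt_one (by positivity)]
    nlinarith
  have hone : w.re ^ 2 / N + w.im ^ 2 / N = 1 := by rw [← add_div, hab, div_self hN0.ne']
  have hp : 0 ≤ w.re ^ 2 / N := by positivity
  have hq : 0 ≤ w.im ^ 2 / N := by positivity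
  simp only [openBernsteinEllipse, Set.mem_ofPred_eq]
  rw [hre, him, hx, hy]
  rcases hp.eq_or_lt with h0 | h0
  · rw [← h0] at hone ⊢
    nlinarith
  · nlinarith [mul_lt_mul_of_pos_left hx1 h0, mul_le_mul_of_nonneg_left hy1.le hq]

/-- The contour integral for the `n`-th Laurent coefficient of `w ↦ F ((w + w⁻¹) / 2)`, bounded by
moving the contour from the unit circle to the circle of radius `R`. -/
theorem norm_laurentCoeff_le {s C : ℝ} (hs : 1 < s) {F : ℂ → ℂ}
    (hF : AnalyticOnNhd ℂ F (openBernsteinEllipse s 1))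
    (hC : ∀ z ∈ openBernsteinEllipse s 1, ‖F z‖ ≤ C) (n : ℤ) {R : ℝ} (hR1 : s⁻¹ < R)
    (hR2 : R < s) :
    ‖(2 * Real.pi * Complex.I : ℂ)⁻¹ •
      ∮ z in C(0, 1), (z - 0)⁻¹ • (z ^ (-n) * F ((z + z⁻¹) / 2))‖ ≤ C * R ^ (-n) := by
  have hs0 : 0 < s⁻¹ := by positivity
  have hR0 : 0 < R := hs0.trans hR1
  have hs1 : s⁻¹ < 1 := inv_lt_one_of_one_lt₀ hs
  have hd : ∀ z : ℂ, s⁻¹ < ‖z‖ → ‖z‖ < s →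
      DifferentiableAt ℂ (fun z => z ^ (-n) * F ((z + z⁻¹) / 2)) z := by
    intro z h1 h2
    have hz : z ≠ 0 := norm_pos_iff.1 (hs0.trans h1)
    have hJ : DifferentiableAt ℂ (fun z : ℂ => (z + z⁻¹) / 2) z :=
      (differentiableAt_id.add (differentiableAt_inv hz)).div_const 2
    exact (differentiableAt_zpow.2 (Or.inl hz)).mul
      (DifferentiableAt.comp z (hF _ (joukowski_mem hs h1 h2)).differentiableAt hJ)
  have hmove : ∀ r₁ r₂ : ℝ, s⁻¹ < r₁ → r₁ ≤ r₂ → r₂ < s →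
      (∮ z in C(0, r₂), (z - 0)⁻¹ • (z ^ (-n) * F ((z + z⁻¹) / 2)))
        = ∮ z in C(0, r₁), (z - 0)⁻¹ • (z ^ (-n) * F ((z + z⁻¹) / 2)) := by
    intro r₁ r₂ h1 h12 h2
    refine Complex.circleIntegral_sub_center_inv_smul_eq_of_differentiable_on_annulus_off_countable
      (hs0.trans h1) h12 Set.countable_empty (fun z hz => ?_) (fun z hz => ?_)
    · simp only [Set.mem_sdiff, mem_closedBall_zero_iff, mem_ball_zero_iff, not_lt] at hz
      exact (hd z (h1.trans_le hz.2) (hz.1.trans_lt h2)).continuousAt.continuousWithinAt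
    · simp only [Set.mem_sdiff, mem_closedBall_zero_iff, mem_ball_zero_iff, not_le] at hz
      exact hd z (h1.trans hz.1.2) (hz.1.1.trans h2)
  have hint : (∮ z in C(0, 1), (z - 0)⁻¹ • (z ^ (-n) * F ((z + z⁻¹) / 2)))
      = ∮ z in C(0, R), (z - 0)⁻¹ • (z ^ (-n) * F ((z + z⁻¹) / 2)) := by
    rcases le_total 1 R with h | h
    · exact (hmove 1 R hs1 h hR2).symm
    · exact hmove R 1 hR1 h hs
  rw [hint]
  refine (circleIntegral.norm_two_pi_i_inv_smul_integral_le_of_norm_le_const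
    (C := R⁻¹ * (R ^ (-n) * C)) hR0.le fun z hz => ?_).trans_eq ?_
  · have hz' : ‖z‖ = R := by simpa using hz
    rw [sub_zero, norm_smul, norm_inv, norm_mul, norm_zpow, hz']
    gcongr
    exact hC _ (joukowski_mem hs (by rwa [hz']) (by rwa [hz']))
  · field_simp

/-- A bounded analytic function on a Bernstein ellipse has a Chebyshev expansion on `[-1, 1]` with
geometrically decreasing coefficients: the Fourier series of `F (cos θ)`. -/
theorem exists_chebyshev_expansion {s C ρ : ℝ} (hs : 1 < s) (hρ1 : 1 < ρ) (hρs : ρ < s)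
    {F : ℂ → ℂ} (hF : AnalyticOnNhd ℂ F (openBernsteinEllipse s 1))
    (hC : ∀ z ∈ openBernsteinEllipse s 1, ‖F z‖ ≤ C) :
    ∃ b : ℕ → ℂ, (∀ k, ‖b k‖ ≤ 2 * C * (ρ⁻¹) ^ k) ∧ ∀ x ∈ Set.Icc (-1 : ℝ) 1,
      HasSum (fun k : ℕ => (((Polynomial.Chebyshev.T ℝ k).eval x : ℝ) : ℂ) * b k) (F x) := by
  have hC0 : 0 ≤ C := (norm_nonneg _).trans (hC _ (ofReal_mem_openBernsteinEllipse hs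
    (x := 0) (by norm_num)))
  have hρ0 : 0 < ρ := by linarith
  have : Fact (0 < 2 * Real.pi) := ⟨Real.two_pi_pos⟩
  have hcont : Continuous fun t : AddCircle (2 * Real.pi) => F ((Real.Angle.cos t : ℝ) : ℂ) := by
    rw [continuous_iff_continuousAt]
    intro t
    have hcos : Real.Angle.cos t ∈ Set.Icc (-1 : ℝ) 1 := by
      induction t using QuotientAddGroup.induction_on with
      | H z => exact Real.cos_mem_Icc z
    have hc : ContinuousAt (fun t : AddCircle (2 * Real.pi) => ((Real.Angle.cos t : ℝ) : ℂ)) t :=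
      (Complex.continuous_ofReal.comp Real.Angle.continuous_cos).continuousAt
    exact ContinuousAt.comp (f := fun t : AddCircle (2 * Real.pi) => ((Real.Angle.cos t : ℝ) : ℂ))
      (hF _ (ofReal_mem_openBernsteinEllipse hs hcos)).continuousAt hc
  let f : C(AddCircle (2 * Real.pi), ℂ) := ⟨_, hcont⟩
  have hfθ : ∀ θ : ℝ, f (θ : AddCircle (2 * Real.pi)) = F (Real.cos θ) := fun θ => rfl
  have hfour : ∀ (n : ℤ) (θ : ℝ), fourier n (θ : AddCircle (2 * Real.pi))
      = Complex.exp (n * θ * Complex.I) := by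
    intro n θ
    rw [fourier_coe_apply]
    congr 1
    have : (Real.pi : ℂ) ≠ 0 := by exact_mod_cast Real.pi_ne_zero
    push_cast
    field_simp
  have hcoeff : ∀ n : ℤ, fourierCoeff f n = (2 * Real.pi * Complex.I : ℂ)⁻¹ •
      ∮ z in C(0, 1), (z - 0)⁻¹ • (z ^ (-n) * F ((z + z⁻¹) / 2)) := by
    intro n
    have hpt : ∀ θ : ℝ, deriv (circleMap 0 1) θ • ((circleMap 0 1 θ - 0)⁻¹ •
        (circleMap 0 1 θ ^ (-n) * F ((circleMap 0 1 θ + (circleMap 0 1 θ)⁻¹) / 2)))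
        = Complex.I * (fourier (-n) (θ : AddCircle (2 * Real.pi)) • f θ) := by
      intro θ
      have h1 : circleMap 0 1 θ = Complex.exp (θ * Complex.I) := by simp [circleMap]
      have h2 : (circleMap 0 1 θ + (circleMap 0 1 θ)⁻¹) / 2 = ((Real.cos θ : ℝ) : ℂ) := by
        rw [h1, ← Complex.exp_neg, Complex.ofReal_cos, Complex.cos]
        ring_nf
      have h3 : circleMap 0 1 θ ≠ 0 := by rw [h1]; exact Complex.exp_ne_zero _
      rw [h2, hfθ, hfour, deriv_circleMap, sub_zero]
      simp only [smul_eq_mul]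
      rw [h1, ← Complex.exp_int_mul]
      rw [h1] at h3
      field_simp
    rw [fourierCoeff_eq_intervalIntegral f n 0, circleIntegral, zero_add]
    simp_rw [hpt]
    rw [intervalIntegral.integral_const_mul, Complex.real_smul, smul_eq_mul]
    push_cast
    field_simp
  have hbp : ∀ k : ℕ, ‖fourierCoeff f k‖ ≤ C * (ρ⁻¹) ^ k := by
    intro k
    rw [hcoeff]
    refine (norm_laurentCoeff_le hs hF hC k (R := ρ)
      ((inv_lt_one_of_one_lt₀ hs).trans hρ1) hρs).trans_eq ?_
    rw [zpow_neg, zpow_natCast, inv_pow]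
  have hbm : ∀ k : ℕ, ‖fourierCoeff f (-k)‖ ≤ C * (ρ⁻¹) ^ k := by
    intro k
    rw [hcoeff]
    refine (norm_laurentCoeff_le hs hF hC (-k) (R := ρ⁻¹)
      (inv_strictAnti₀ hρ0 hρs) ((inv_lt_one_of_one_lt₀ hρ1).trans hs)).trans_eq ?_
    rw [neg_neg, zpow_natCast]
  have hgeo : Summable fun k : ℕ => C * (ρ⁻¹) ^ k :=
    (summable_geometric_of_lt_one (by positivity) (inv_lt_one_of_one_lt₀ hρ1)).mul_left C
  have hsum : Summable (fourierCoeff f) :=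
    Summable.of_nat_of_neg (Summable.of_norm_bounded hgeo hbp) (Summable.of_norm_bounded hgeo hbm)
  refine ⟨fun k => fourierCoeff f k + fourierCoeff f (-k)
    - if k = 0 then fourierCoeff f 0 else 0, fun k => ?_, fun x hx => ?_⟩
  · beta_reduce
    rcases Nat.eq_zero_or_pos k with rfl | hk
    · have := hbp 0
      simp only [Nat.cast_zero, pow_zero, mul_one] at this
      simp
      linarith
    · rw [if_neg hk.ne', sub_zero]
      refine (norm_add_le _ _).trans ?_
      linarith [hbp k, hbm k]
  · obtain ⟨θ, rfl⟩ : ∃ θ, x = Real.cos θ := ⟨Real.arccos x, (Real.cos_arccos hx.1 hx.2).symm⟩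
    have h1 := has_pointwise_sum_fourier_series_of_summable hsum (θ : AddCircle (2 * Real.pi))
    have h2 := has_pointwise_sum_fourier_series_of_summable hsum
      ((-θ : ℝ) : AddCircle (2 * Real.pi))
    rw [hfθ] at h1 h2
    rw [Real.cos_neg] at h2
    have h3 : HasSum (fun n : ℤ =>
        (((Polynomial.Chebyshev.T ℝ n).eval (Real.cos θ) : ℝ) : ℂ) * fourierCoeff f n)
        (F (Real.cos θ)) := by
      have := (h1.add h2).mul_left (1 / 2 : ℂ)
      convert! this using 1
      · ext n
        rw [hfour, hfour, Polynomial.Chebyshev.T_real_cos, Complex.ofReal_cos, Complex.cos]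
        simp only [smul_eq_mul]
        push_cast
        ring_nf
      · ring
    have h4 := h3.nat_add_neg.sub (hasSum_ite_eq 0 (fourierCoeff f 0))
    convert! h4 using 1
    · ext k
      rw [Polynomial.Chebyshev.T_neg]
      rcases Nat.eq_zero_or_pos k with rfl | hk
      · simp
      · simp [hk.ne']
        ring
    · simp

theorem sum_abs_coeff_T_le (N n : ℕ) :
    ∑ m ∈ Finset.range N, |(Polynomial.Chebyshev.T ℝ n).coeff m| ≤ 3 ^ n := by
  induction n using Nat.twoStepInduction generalizing N with
  | zero =>
    have : ∀ m, |(Polynomial.Chebyshev.T ℝ (0 : ℕ)).coeff m| = if m = 0 then 1 else 0 := by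
      intro m
      simp [Polynomial.coeff_one]
      split_ifs <;> simp_all
    simp_rw [this, Finset.sum_ite_eq']
    split_ifs <;> norm_num
  | one =>
    have : ∀ m, |(Polynomial.Chebyshev.T ℝ (1 : ℕ)).coeff m| = if m = 1 then 1 else 0 := by
      intro m
      simp [Polynomial.coeff_X]
      split_ifs <;> simp_all
    simp_rw [this, Finset.sum_ite_eq']
    split_ifs <;> norm_num
  | more n ih0 ih1 =>
    have e : ∀ m, |(Polynomial.Chebyshev.T ℝ (n + 2 : ℕ)).coeff m|
        ≤ 2 * |(Polynomial.X * Polynomial.Chebyshev.T ℝ (n + 1 : ℕ)).coeff m|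
          + |(Polynomial.Chebyshev.T ℝ n).coeff m| := by
      intro m
      push_cast
      rw [Polynomial.Chebyshev.T_add_two, mul_assoc, Polynomial.coeff_sub,
        show (2 : Polynomial ℝ) = Polynomial.C 2 from rfl, Polynomial.coeff_C_mul]
      refine (abs_sub _ _).trans_eq ?_
      rw [abs_mul, abs_two]
    have hX : ∑ m ∈ Finset.range N,
        |(Polynomial.X * Polynomial.Chebyshev.T ℝ (n + 1 : ℕ)).coeff m| ≤ 3 ^ (n + 1) := by
      rcases N with _ | N
      · simp
      · rw [Finset.sum_range_succ']
        simp only [Polynomial.coeff_X_mul, Polynomial.coeff_X_mul_zero, abs_zero, add_zero]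
        exact ih1 N
    refine (Finset.sum_le_sum fun m _ => e m).trans ?_
    rw [Finset.sum_add_distrib, ← Finset.mul_sum]
    have h0 := ih0 N
    have h3 : (0 : ℝ) < 3 ^ n := by positivity
    rw [pow_succ] at hX
    rw [pow_succ, pow_succ]
    linarith

/-- Truncating a Chebyshev series with geometrically decreasing coefficients. -/
theorem exists_polynomial_of_chebyshev {B τ : ℝ} (hB : 0 ≤ B) (h0 : 0 < τ) (h1 : τ < 1)
    {β : ℕ → ℝ} (hβ : ∀ k, |β k| ≤ B * τ ^ k) {g : ℝ → ℝ} (hg : ∀ x ∈ Set.Icc (-1 : ℝ) 1,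
      HasSum (fun k : ℕ => (Polynomial.Chebyshev.T ℝ k).eval x * β k) (g x)) (N : ℕ) :
    ∃ d : ℕ → ℝ, ∑ m ∈ Finset.range N, |d m| ≤ B * 3 ^ N ∧ ∀ x ∈ Set.Icc (-1 : ℝ) 1,
      |∑ m ∈ Finset.range N, d m * x ^ m - g x| ≤ B * τ ^ N / (1 - τ) := by
  refine ⟨fun m => ∑ k ∈ Finset.range N, β k * (Polynomial.Chebyshev.T ℝ k).coeff m, ?_,
    fun x hx => ?_⟩
  · calc ∑ m ∈ Finset.range N, |∑ k ∈ Finset.range N, β k * (Polynomial.Chebyshev.T ℝ k).coeff m|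
        ≤ ∑ m ∈ Finset.range N, ∑ k ∈ Finset.range N,
            |β k| * |(Polynomial.Chebyshev.T ℝ k).coeff m| := by
          refine Finset.sum_le_sum fun m _ => (Finset.abs_sum_le_sum_abs _ _).trans_eq ?_
          simp_rw [abs_mul]
      _ = ∑ k ∈ Finset.range N, |β k| *
            ∑ m ∈ Finset.range N, |(Polynomial.Chebyshev.T ℝ k).coeff m| := by
          rw [Finset.sum_comm]
          simp_rw [Finset.mul_sum]
      _ ≤ ∑ k ∈ Finset.range N, B * 3 ^ k := by
          refine Finset.sum_le_sum fun k _ => mul_le_mul ?_ (sum_abs_coeff_T_le N k)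
            (Finset.sum_nonneg fun _ _ => abs_nonneg _) hB
          exact (hβ k).trans (mul_le_of_le_one_right hB (pow_le_one₀ h0.le h1.le))
      _ ≤ B * 3 ^ N := by
          rw [← Finset.mul_sum]
          refine mul_le_mul_of_nonneg_left ?_ hB
          rw [geom_sum_eq (by norm_num)]
          have : (0 : ℝ) < 3 ^ N := by positivity
          linarith
  · have e : ∑ m ∈ Finset.range N,
        (∑ k ∈ Finset.range N, β k * (Polynomial.Chebyshev.T ℝ k).coeff m) * x ^ m
        = ∑ k ∈ Finset.range N, (Polynomial.Chebyshev.T ℝ k).eval x * β k := by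
      simp_rw [Finset.sum_mul]
      rw [Finset.sum_comm]
      refine Finset.sum_congr rfl fun k hk => ?_
      rw [Polynomial.eval_eq_sum_range' (n := N)
        (by rw [Polynomial.Chebyshev.natDegree_T]; simpa using hk), Finset.sum_mul]
      refine Finset.sum_congr rfl fun m _ => ?_
      ring
    rw [e]
    have ht := (hasSum_nat_add_iff' N).2 (hg x hx)
    have hgeo : HasSum (fun k : ℕ => B * τ ^ N * τ ^ k) (B * τ ^ N * (1 - τ)⁻¹) :=
      (hasSum_geometric_of_lt_one h0.le h1).mul_left _
    have := ht.norm_le_of_bounded hgeo fun k => by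
      rw [norm_mul, Real.norm_eq_abs, Real.norm_eq_abs]
      calc |(Polynomial.Chebyshev.T ℝ ((k + N : ℕ) : ℤ)).eval x| * |β (k + N)|
          ≤ 1 * (B * τ ^ (k + N)) := mul_le_mul
            (Polynomial.Chebyshev.abs_eval_T_real_le_one _ (abs_le.2 hx)) (hβ _)
            (abs_nonneg _) zero_le_one
        _ = B * τ ^ N * τ ^ k := by rw [pow_add]; ring
    rw [abs_sub_comm, ← Real.norm_eq_abs, div_eq_mul_inv]
    exact this

/-! ### Approximation by constants -/

/-- The Borel-Carathéodory inequality for `g - 1`, whose real part is non-positive. -/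
theorem norm_sub_one_le_of_norm_le_one {g : ℂ → ℂ} {x z : ℂ} {r m : ℝ} (hr : 0 < r) (hm : 0 < m)
    (hg : DifferentiableOn ℂ g (Metric.ball x r)) (hg1 : ∀ w ∈ Metric.ball x r, ‖g w‖ ≤ 1)
    (hx : ‖g x - 1‖ ≤ m) (hz : ‖z - x‖ ≤ r / 2) : ‖g z - 1‖ ≤ 5 * m := by
  have hmaps : ∀ w ∈ Metric.ball (0 : ℂ) r, x + w ∈ Metric.ball x r := fun w hw => by
    simpa [dist_eq_norm] using hw
  have hd : DifferentiableOn ℂ (fun w => g (x + w) - 1) (Metric.ball 0 r) :=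
    (DifferentiableOn.comp (f := fun w : ℂ => x + w) hg (by fun_prop) hmaps).sub_const 1
  have h := Complex.borelCaratheodory hm hd (fun w hw => by
    have := (Complex.re_le_norm _).trans (hg1 _ (hmaps w hw))
    simp only [Set.mem_ofPred_eq, Complex.sub_re, Complex.one_re]
    linarith) hr (z := z - x) (mem_ball_zero_iff.2 (by linarith))
  simp only [add_sub_cancel, add_zero] at h
  have ha := norm_nonneg (z - x)
  have hpos : 0 < r - ‖z - x‖ := by linarith
  refine h.trans ?_
  rw [← add_div, div_le_iff₀ hpos]
  nlinarith [mul_le_mul_of_nonneg_right hx (by linarith : 0 ≤ r + ‖z - x‖)]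

/-- A function bounded by one on the ellipse is uniformly closer than one to some constant on
`[-1, 1]`: if its modulus nearly attains the bound at a point, it is nearly constant by a
chain of discs along `[-1, 1]`. The constant is a real multiple of a value of the function. -/
theorem exists_const_approx {s : ℝ} (hs : 1 < s) : ∃ η : ℝ, 0 < η ∧ η < 1 ∧
    ∀ F : ℂ → ℂ, AnalyticOnNhd ℂ F (openBernsteinEllipse s 1) →
    (∀ z ∈ openBernsteinEllipse s 1, ‖F z‖ ≤ 1) →
    ∃ x₀ ∈ Set.Icc (-1 : ℝ) 1, ∃ t : ℝ, ∀ x ∈ Set.Icc (-1 : ℝ) 1,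
      ‖F x - t * F x₀‖ ≤ 1 - η := by
  have hK : IsCompact ((fun x : ℝ => (x : ℂ)) '' Set.Icc (-1 : ℝ) 1) :=
    isCompact_Icc.image Complex.continuous_ofReal
  obtain ⟨r, hr, hsub⟩ := hK.exists_thickening_subset_open (isOpen_openBernsteinEllipse s 1) (by
    rintro _ ⟨x, hx, rfl⟩
    exact ofReal_mem_openBernsteinEllipse hs hx)
  have hball : ∀ x ∈ Set.Icc (-1 : ℝ) 1, Metric.ball (x : ℂ) r ⊆ openBernsteinEllipse s 1 :=
    fun x hx => (Metric.ball_subset_thickening (Set.mem_image_of_mem _ hx) r).trans hsub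
  obtain ⟨N, hN⟩ := exists_nat_ge (4 / r)
  rw [div_le_iff₀ hr] at hN
  have h5 : (1 : ℝ) ≤ 5 ^ N := one_le_pow₀ (by norm_num)
  obtain ⟨η, hη⟩ : ∃ η : ℝ, η = (5 ^ N)⁻¹ / 4 := ⟨_, rfl⟩
  have hη0 : 0 < η := by rw [hη]; positivity
  have hη5 : 5 ^ N * η = 1 / 4 := by rw [hη]; field_simp
  have hη1 : η ≤ 1 / 4 := by nlinarith
  refine ⟨η, hη0, by linarith, fun F hF hF1 => ?_⟩
  by_cases hsmall : ∀ x ∈ Set.Icc (-1 : ℝ) 1, ‖F x‖ ≤ 1 - η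
  · exact ⟨0, by norm_num, 0, fun x hx => by simpa using hsmall x hx⟩
  push Not at hsmall
  obtain ⟨x₀, hx₀, hbig⟩ := hsmall
  refine ⟨x₀, hx₀, ‖F x₀‖⁻¹, fun x hx => ?_⟩
  have hF0 : F x₀ ≠ 0 := norm_pos_iff.1 (by linarith)
  have hn0 : (‖F x₀‖ : ℂ) ≠ 0 := by exact_mod_cast norm_ne_zero_iff.2 hF0
  obtain ⟨g, hg⟩ : ∃ g : ℂ → ℂ, ∀ z, g z = (‖F x₀‖ : ℂ) / F x₀ * F z := ⟨_, fun _ => rfl⟩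
  have hunit : ‖(‖F x₀‖ : ℂ) / F x₀‖ = 1 := by
    rw [norm_div, Complex.norm_real, norm_norm, div_self (norm_ne_zero_iff.2 hF0)]
  have hgd : DifferentiableOn ℂ g (openBernsteinEllipse s 1) := by
    have : g = fun z => (‖F x₀‖ : ℂ) / F x₀ * F z := funext hg
    rw [this]
    exact hF.differentiableOn.const_mul _
  have hg1 : ∀ z ∈ openBernsteinEllipse s 1, ‖g z‖ ≤ 1 := fun z hz => by
    rw [hg, norm_mul, hunit, one_mul]
    exact hF1 z hz
  have hchain : ∀ k : ℕ, ∀ y ∈ Set.Icc (-1 : ℝ) 1, |y - x₀| ≤ k * (r / 2) →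
      ‖g y - 1‖ ≤ 5 ^ k * η := by
    intro k
    induction k with
    | zero =>
      intro y hy h
      obtain rfl : y = x₀ := by
        have := abs_nonpos_iff.1 (h.trans_eq (by simp))
        linarith
      have hle := hF1 _ (ofReal_mem_openBernsteinEllipse hs hx₀)
      rw [hg, div_mul_cancel₀ _ hF0, pow_zero, one_mul, ← Complex.ofReal_one, ← Complex.ofReal_sub,
        Complex.norm_real, Real.norm_eq_abs, abs_le]
      constructor <;> linarith
    | succ k ih =>
      intro y hy h
      have hk : (0 : ℝ) < k + 1 := by positivity
      obtain ⟨y', hy'⟩ : ∃ y', y' = (1 - k / (k + 1)) * x₀ + (k / (k + 1)) * y := ⟨_, rfl⟩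
      have hk0 : (0 : ℝ) ≤ k / (k + 1) := by positivity
      have hk1 : (k : ℝ) / (k + 1) ≤ 1 := by rw [div_le_one hk]; linarith
      have hmem : y' ∈ Set.Icc (-1 : ℝ) 1 := by
        have := (convex_Icc (-1 : ℝ) 1) hx₀ hy (sub_nonneg.2 hk1) hk0 (by ring)
        simpa [hy'] using this
      push_cast at h
      have e1 : y' - x₀ = k / (k + 1) * (y - x₀) := by rw [hy']; ring
      have e2 : y - y' = (y - x₀) / (k + 1) := by rw [hy']; field_simp; ring
      have h1 : |y' - x₀| ≤ k * (r / 2) := by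
        rw [e1, abs_mul, abs_of_nonneg hk0]
        refine (mul_le_mul_of_nonneg_left h hk0).trans_eq ?_
        field_simp
      have h2 : |y - y'| ≤ r / 2 := by
        rw [e2, abs_div, abs_of_pos hk, div_le_iff₀ hk]
        linarith
      refine (norm_sub_one_le_of_norm_le_one hr (by positivity) (hgd.mono (hball y' hmem))
        (fun w hw => hg1 w (hball y' hmem hw)) (ih y' hmem h1) ?_).trans_eq (by ring)
      rw [← Complex.ofReal_sub, Complex.norm_real]
      exact h2
  have hfar : |x - x₀| ≤ N * (r / 2) := by
    rw [abs_le]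
    constructor <;> linarith [hx.1, hx.2, hx₀.1, hx₀.2]
  have hfin := hchain N x hx hfar
  have e : F x - ((‖F x₀‖⁻¹ : ℝ) : ℂ) * F x₀ = F x₀ / (‖F x₀‖ : ℂ) * (g x - 1) := by
    rw [hg]
    push_cast
    field_simp
  have hunit' : ‖F x₀ / (‖F x₀‖ : ℂ)‖ = 1 := by
    rw [norm_div, Complex.norm_real, norm_norm, div_self (norm_ne_zero_iff.2 hF0)]
  rw [e, norm_mul, hunit', one_mul]
  linarith

/-! ### The size of the approximating network -/

/-- A Chebyshev series is truncated at degree `q ^ 2` and evaluated with an error of order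
`4 ^ (-r)` in each multiplication. -/
theorem exists_approx_chebyshev_series {C ε τ : ℝ} (hC : 0 < C) (hε : 0 < ε) (h0 : 0 < τ)
    (h1 : τ < 1) {β : ℕ → ℝ} (hβ : ∀ k, |β k| ≤ 2 * C * τ ^ k) {g : ℝ → ℝ}
    (hg : ∀ x ∈ Set.Icc (-1 : ℝ) 1,
      HasSum (fun k : ℕ => (Polynomial.Chebyshev.T ℝ k).eval x * β k) (g x))
    {q r : ℕ} (hq1 : 1 ≤ q) (hτ : 2 * C * τ ^ (q * q) / (1 - τ) ≤ ε / 4)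
    (hr : 256 * (C / ε) * 4 ^ (2 * q ^ 2) ≤ 4 ^ r) (hCε : 1 ≤ C / ε) :
    ∃ V, ReLUSpan (8 * r * q) V ∧ ∃ p ∈ V, ∀ x ∈ Set.Icc (-1 : ℝ) 1, |p x - g x| ≤ ε / 2 := by
  obtain ⟨d, hd, hdg⟩ := exists_polynomial_of_chebyshev (by positivity : 0 ≤ 2 * C) h0 h1 hβ hg
    (q * q)
  have hr0 : (0 : ℝ) < 4 ^ r := by positivity
  have hQ : (q : ℝ) ^ 2 ≤ 4 ^ (q ^ 2) := by
    exact_mod_cast (Nat.lt_pow_self (by norm_num : 1 < 4)).le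
  have h34 : (3 : ℝ) ^ (q * q) ≤ 4 ^ (q ^ 2) := by
    rw [← pow_two]
    exact pow_le_pow_left₀ (by norm_num) (by norm_num) _
  have h4 : (4 : ℝ) ^ (2 * q ^ 2) = 4 ^ (q ^ 2) * 4 ^ (q ^ 2) := by rw [two_mul, pow_add]
  have hone : (1 : ℝ) ≤ 4 ^ (q ^ 2) := one_le_pow₀ (by norm_num)
  have hmain : 256 * (C / ε) * ((3 : ℝ) ^ (q * q) * q ^ 2) ≤ 4 ^ r := by
    refine le_trans ?_ hr
    rw [h4]
    gcongr
  have hq : 4 * (q : ℝ) ^ 2 * (8 / 4 ^ r : ℝ) ≤ 1 := by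
    have h3 : (1 : ℝ) ≤ 3 ^ (q * q) := one_le_pow₀ (by norm_num)
    have : (q : ℝ) ^ 2 ≤ (C / ε) * ((3 : ℝ) ^ (q * q) * q ^ 2) := by
      have hq2 : (0 : ℝ) ≤ (q : ℝ) ^ 2 := by positivity
      calc (q : ℝ) ^ 2 = 1 * (1 * q ^ 2) := by ring
        _ ≤ _ := by gcongr
    rw [← mul_div_assoc, div_le_one hr0]
    nlinarith
  obtain ⟨V, hV, p, hp, hpe⟩ := ReLUSpan.exists_approx_polynomial hq1 hq d
    (A := 2 * C * 3 ^ (q * q)) (by positivity) hd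
  refine ⟨V, hV, p, hp, fun x hx => ?_⟩
  have e1 := hpe x hx
  have e2 := (hdg x hx).trans hτ
  have e3 : 2 * C * 3 ^ (q * q) * (4 * (q : ℝ) ^ 2 * (8 / 4 ^ r)) ≤ ε / 4 := by
    have : 2 * C * 3 ^ (q * q) * (4 * (q : ℝ) ^ 2 * (8 / 4 ^ r))
        = ε / 4 * (256 * (C / ε) * ((3 : ℝ) ^ (q * q) * q ^ 2)) / 4 ^ r := by
      field_simp
      ring
    rw [this, div_le_iff₀ hr0]
    exact mul_le_mul_of_nonneg_left hmain (by positivity)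
  rw [abs_le] at e1 e2 ⊢
  constructor <;> linarith

/-- The choice of the degree `q ^ 2`, of order `log (C / ε) / log s`, and of the accuracy
`4 ^ (-r)`. The resulting `16 * r * q` units are of order `q ^ 4` once `q` exceeds `log₂ s + 7`. -/
theorem exists_parameters {s : ℝ} (hs : 1 < s) : ∃ R : ℝ, 1 < R ∧ ∀ C ε : ℝ, 0 < C → 0 < ε →
    R ≤ C / ε → ∃ q r : ℕ, 1 ≤ q ∧
      2 * C * (√s)⁻¹ ^ (q * q) / (1 - (√s)⁻¹) ≤ ε / 4 ∧
      256 * (C / ε) * 4 ^ (2 * q ^ 2) ≤ 4 ^ r ∧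
      ((16 * r * q : ℕ) : ℝ) ≤ 1296 * (Real.logb 2 (C / ε) ^ 2 / Real.logb 2 s ^ 2) := by
  have hρ1 : 1 < √s := by rw [Real.lt_sqrt (by norm_num)]; simpa using hs
  have hρ0 : 0 < √s := by linarith
  obtain ⟨τ, hτ⟩ : ∃ τ, τ = (√s)⁻¹ := ⟨_, rfl⟩
  have hτ0 : 0 < τ := by rw [hτ]; positivity
  have hτ1 : τ < 1 := by rw [hτ]; exact inv_lt_one_of_one_lt₀ hρ1
  obtain ⟨Λ, hΛ⟩ : ∃ Λ, Λ = Real.logb 2 s := ⟨_, rfl⟩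
  have hΛ0 : 0 < Λ := by rw [hΛ]; exact Real.logb_pos (by norm_num) hs
  refine ⟨max (8 / (1 - τ)) (2 ^ (Λ * (Λ + 7) ^ 2 / 4)), ?_, fun C ε hC hε hR => ?_⟩
  · refine lt_max_of_lt_left ?_
    rw [lt_div_iff₀ (by linarith)]
    linarith
  obtain ⟨hR1, hR2⟩ := max_le_iff.1 hR
  have hx0 : 0 < C / ε := by positivity
  obtain ⟨l, hl⟩ : ∃ l, l = Real.logb 2 (C / ε) := ⟨_, rfl⟩
  have hCl : C / ε = 2 ^ l := by
    rw [hl, Real.rpow_logb (by norm_num) (by norm_num) hx0]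
  have hl1 : Λ * (Λ + 7) ^ 2 / 4 ≤ l := by
    rw [hl, Real.le_logb_iff_rpow_le (by norm_num) hx0]
    exact hR2
  obtain ⟨v, hv⟩ : ∃ v, v = √(l / Λ) := ⟨_, rfl⟩
  have hlΛ : (Λ + 7) ^ 2 / 4 ≤ l / Λ := by
    rw [le_div_iff₀ hΛ0]
    linarith
  have hv2 : v ^ 2 = l / Λ := by
    rw [hv, Real.sq_sqrt ((by positivity : (0 : ℝ) ≤ (Λ + 7) ^ 2 / 4).trans hlΛ)]
  have hvl : l = Λ * v ^ 2 := by rw [hv2]; field_simp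
  have hv7 : (Λ + 7) / 2 ≤ v := by
    rw [hv]
    refine Real.le_sqrt_of_sq_le (le_trans (le_of_eq ?_) hlΛ)
    ring
  have hv0 : 0 ≤ v := by linarith
  obtain ⟨q, hq⟩ : ∃ q, q = ⌈2 * v⌉₊ := ⟨_, rfl⟩
  have hqv : 2 * v ≤ q := by rw [hq]; exact Nat.le_ceil _
  have hqv' : (q : ℝ) ≤ 3 * v := by
    have := Nat.ceil_lt_add_one (by positivity : 0 ≤ 2 * v)
    rw [← hq] at this
    linarith
  have hq7 : Λ + 7 ≤ q := by linarith
  have hlq : l ≤ Λ * q ^ 2 / 4 := by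
    rw [hvl]
    have : (2 * v) ^ 2 ≤ (q : ℝ) ^ 2 := pow_le_pow_left₀ (by positivity) hqv 2
    nlinarith
  have hl0 : 0 ≤ l := by rw [hvl]; positivity
  rw [← hτ, ← hl, ← hΛ]
  refine ⟨q, ⌈l⌉₊ + 2 * q ^ 2 + 4, ?_, ?_, ?_, ?_⟩
  · have : (1 : ℝ) ≤ q := by linarith
    exact_mod_cast this
  · -- `τ ^ (q ^ 2) = 2 ^ (-Λ q ^ 2 / 2) ≤ 2 ^ (-2 l) = (ε / C) ^ 2`
    have hτe : τ = 2 ^ (-(Λ / 2)) := by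
      rw [hτ, Real.rpow_neg (by norm_num), Real.sqrt_eq_rpow, div_eq_mul_one_div Λ,
        Real.rpow_mul (by norm_num), hΛ, Real.rpow_logb (by norm_num) (by norm_num) (by linarith)]
    have h1 : τ ^ (q * q) ≤ (C / ε)⁻¹ * (C / ε)⁻¹ := by
      rw [hCl, ← Real.rpow_neg (by norm_num), ← Real.rpow_add (by norm_num), hτe,
        ← Real.rpow_natCast, ← Real.rpow_mul (by norm_num)]
      refine Real.rpow_le_rpow_of_exponent_le (by norm_num) ?_
      push_cast
      nlinarith
    rw [div_le_iff₀ (by linarith)]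
    have h2 : 8 ≤ C / ε * (1 - τ) := (div_le_iff₀ (by linarith)).1 hR1
    have h3 : (C / ε)⁻¹ * 8 ≤ 1 - τ := by
      rw [inv_mul_le_iff₀ hx0]
      exact h2
    calc 2 * C * τ ^ (q * q) ≤ 2 * C * ((C / ε)⁻¹ * (C / ε)⁻¹) := by gcongr
      _ = ε / 4 * ((C / ε)⁻¹ * 8) := by field_simp; ring
      _ ≤ ε / 4 * (1 - τ) := by gcongr
  · have h1 : C / ε ≤ 4 ^ ⌈l⌉₊ := by
      rw [hCl, ← Real.rpow_natCast]
      calc (2 : ℝ) ^ l ≤ 2 ^ ((⌈l⌉₊ : ℕ) : ℝ) :=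
            Real.rpow_le_rpow_of_exponent_le (by norm_num) (Nat.le_ceil _)
        _ ≤ 4 ^ ((⌈l⌉₊ : ℕ) : ℝ) :=
            Real.rpow_le_rpow (by norm_num) (by norm_num) (by positivity)
    rw [pow_add, pow_add]
    calc 256 * (C / ε) * 4 ^ (2 * q ^ 2) ≤ 256 * 4 ^ ⌈l⌉₊ * 4 ^ (2 * q ^ 2) := by gcongr
      _ = _ := by ring
  · have h1 := (Nat.ceil_lt_add_one hl0).le
    have h2 : (⌈l⌉₊ : ℝ) + 2 * q ^ 2 + 4 ≤ q ^ 3 := by nlinarith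
    have h3 : (q : ℝ) ^ 4 ≤ (3 * v) ^ 4 := pow_le_pow_left₀ (by positivity) hqv' 4
    have h4 : l ^ 2 / Λ ^ 2 = v ^ 4 := by
      rw [← div_pow, ← hv2]
      ring
    rw [h4]
    push_cast
    nlinarith [mul_le_mul_of_nonneg_right h2 (by positivity : (0 : ℝ) ≤ q)]

theorem exists_approx_analytic {s : ℝ} (hs : 1 < s) : ∃ R : ℝ, 1 < R ∧ ∀ (F : ℂ → ℂ) (C ε : ℝ),
    AnalyticOnNhd ℂ F (openBernsteinEllipse s 1) →
    (∀ z ∈ openBernsteinEllipse s 1, ‖F z‖ ≤ C) → 0 < C → 0 < ε → R ≤ C / ε →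
    ∃ (n : ℕ) (V : Submodule ℝ (ℝ → ℝ)), ReLUSpan n V ∧
      (n : ℝ) ≤ 1296 * (Real.logb 2 (C / ε) ^ 2 / Real.logb 2 s ^ 2) ∧
      ∃ g₁ ∈ V, ∃ g₂ ∈ V, ∀ x ∈ Set.Icc (-1 : ℝ) 1,
        |g₁ x - (F x).re| ≤ ε / 2 ∧ |g₂ x - (F x).im| ≤ ε / 2 := by
  obtain ⟨R, hR1, hR⟩ := exists_parameters hs
  refine ⟨R, hR1, fun F C ε hF hFC hC hε hRC => ?_⟩
  obtain ⟨q, r, hq1, hτ, hr, hn⟩ := hR C ε hC hε hRC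
  have hρ1 : 1 < √s := by rw [Real.lt_sqrt (by norm_num)]; simpa using hs
  have hρs : √s < s := by
    rw [Real.sqrt_lt' (by linarith)]
    nlinarith
  have hτ0 : 0 < (√s)⁻¹ := by positivity
  have hτ1 : (√s)⁻¹ < 1 := inv_lt_one_of_one_lt₀ hρ1
  obtain ⟨b, hb, hbF⟩ := exists_chebyshev_expansion hs hρ1 hρs hF hFC
  have hCε : 1 ≤ C / ε := hR1.le.trans hRC
  obtain ⟨V₁, hV₁, g₁, hg₁, he₁⟩ := exists_approx_chebyshev_series hC hε hτ0 hτ1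
    (β := fun k => (b k).re) (g := fun x => (F x).re)
    (fun k => (Complex.abs_re_le_norm _).trans (hb k))
    (fun x hx => by
      simpa only [Complex.re_ofReal_mul] using Complex.hasSum_re (hbF x hx)) hq1 hτ hr hCε
  obtain ⟨V₂, hV₂, g₂, hg₂, he₂⟩ := exists_approx_chebyshev_series hC hε hτ0 hτ1
    (β := fun k => (b k).im) (g := fun x => (F x).im)
    (fun k => (Complex.abs_im_le_norm _).trans (hb k))
    (fun x hx => by
      simpa only [Complex.im_ofReal_mul] using Complex.hasSum_im (hbF x hx)) hq1 hτ hr hCε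
  refine ⟨_, _, hV₁.sup hV₂, ?_, g₁, le_sup_left (α := Submodule ℝ (ℝ → ℝ)) hg₁, g₂,
    le_sup_right (α := Submodule ℝ (ℝ → ℝ)) hg₂, fun x hx => ⟨he₁ x hx, he₂ x hx⟩⟩
  refine le_trans (le_of_eq ?_) hn
  push_cast
  ring

/-! ### Rescaling and the three ranges of accuracy -/

theorem ContinuableWithBound.exists_rescaled {𝕜 : Type*} [RCLike 𝕜] {s M C : ℝ} (hM : 0 < M)
    {f : ℝ → 𝕜} (h : ContinuableWithBound s M C f) :
    ∃ F : ℂ → ℂ, AnalyticOnNhd ℂ F (openBernsteinEllipse s 1) ∧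
      (∀ x ∈ Set.Icc (-1 : ℝ) 1, F x = RCLike.map 𝕜 ℂ (f (M * x))) ∧
      ∀ z ∈ openBernsteinEllipse s 1, ‖F z‖ ≤ C := by
  obtain ⟨F, hF, hf, hC⟩ := h
  have hmem : ∀ z ∈ openBernsteinEllipse s 1, (M : ℂ) * z ∈ openBernsteinEllipse s M := by
    intro z hz
    simp only [openBernsteinEllipse, Set.mem_ofPred_eq, one_mul] at hz ⊢
    rw [Complex.re_ofReal_mul, Complex.im_ofReal_mul, mul_pow, mul_pow, mul_pow, mul_pow,
      mul_div_mul_left _ _ (by positivity), mul_div_mul_left _ _ (by positivity)]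
    exact hz
  refine ⟨fun z => F (M * z), fun z hz => ?_, fun x hx => ?_, fun z hz => hC _ (hmem z hz)⟩
  · exact AnalyticAt.fun_comp (hF _ (hmem z hz)) (analyticAt_const.mul analyticAt_id)
  · have := hf (M * x) ⟨by nlinarith [hx.1], by nlinarith [hx.2]⟩
    simpa using this

theorem RCLike.norm_map_complex {𝕜 : Type*} [RCLike 𝕜] (z : 𝕜) : ‖RCLike.map 𝕜 ℂ z‖ = ‖z‖ := by
  rw [← sq_eq_sq₀ (norm_nonneg _) (norm_nonneg _), RCLike.norm_sq_eq_def, RCLike.norm_sq_eq_def]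
  simp

theorem theorem1 :
    -- an absolute constant for small accuracies
    ∃ K : ℝ, 0 < K ∧ ∀ s : ℝ, 1 < s →
    -- a constant for all accuracies and a threshold, depending on `s` only
    ∃ K' R : ℝ, 0 < K' ∧ 0 < R ∧
    ∀ (𝕜 : Type) [RCLike 𝕜] (ε M C : ℝ) (f : ℝ → 𝕜),
      0 < ε → ε < 1 → 1 ≤ M → 0 < C → ContinuableWithBound s M C f →
    ∀ n : ℕ, 1 ≤ n → ∃ N : ReLUNetwork n 𝕜,
      (∀ x ∈ Set.Icc (-M) M, ‖N.eval (fun _ => x) - f x‖ ≤ ε) ∧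
      (N.depth : ℝ) ≤ K' * (Real.logb 2 (C / ε) ^ 2 / Real.logb 2 s ^ 2) ∧
      (N.size : ℝ) ≤ K' * (Real.logb 2 (C / ε) ^ 2 / Real.logb 2 s ^ 2) ∧
      (R ≤ C / ε →
        (N.depth : ℝ) ≤ K * (Real.logb 2 (C / ε) ^ 2 / Real.logb 2 s ^ 2) ∧
        (N.size : ℝ) ≤ K * (Real.logb 2 (C / ε) ^ 2 / Real.logb 2 s ^ 2)) := by
  refine ⟨1296, by norm_num, fun s hs => ?_⟩
  obtain ⟨R, hR1, hR⟩ := exists_approx_analytic hs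
  obtain ⟨η, hη0, hη1, hη⟩ := exists_const_approx hs
  obtain ⟨l₁, hl₁⟩ : ∃ l, l = Real.logb 2 (1 - η)⁻¹ := ⟨_, rfl⟩
  have hl₁0 : 0 < l₁ := by
    rw [hl₁]
    exact Real.logb_pos (by norm_num) (one_lt_inv_iff₀.2 ⟨by linarith, by linarith⟩)
  refine ⟨1296 * (1 + Real.logb 2 R ^ 2 / l₁ ^ 2), R, by positivity, by linarith, ?_⟩
  intro 𝕜 _ ε M C f hε _ hM hC hf n hn
  have hM0 : 0 < M := by linarith
  obtain ⟨F, hF, hFf, hFC⟩ := hf.exists_rescaled hM0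
  have hscale : ∀ x ∈ Set.Icc (-M) M, x / M ∈ Set.Icc (-1 : ℝ) 1 ∧
      F ((x / M : ℝ) : ℂ) = RCLike.map 𝕜 ℂ (f x) := by
    intro x hx
    have hmem : x / M ∈ Set.Icc (-1 : ℝ) 1 :=
      ⟨by rw [le_div_iff₀ hM0]; linarith [hx.1], by rw [div_le_iff₀ hM0]; linarith [hx.2]⟩
    refine ⟨hmem, ?_⟩
    rw [hFf _ hmem, mul_div_cancel₀ _ hM0.ne']
  have hquot : 0 ≤ Real.logb 2 (C / ε) ^ 2 / Real.logb 2 s ^ 2 := by positivity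
  -- Used with `ε' = ε` above the threshold, and with `ε' = C / R` slightly below it.
  have hnet : ∀ ε', 0 < ε' → ε' ≤ ε → R ≤ C / ε' → ∃ N : ReLUNetwork n 𝕜,
      (∀ x ∈ Set.Icc (-M) M, ‖N.eval (fun _ => x) - f x‖ ≤ ε) ∧ N.depth = N.size ∧
      (N.size : ℝ) ≤ 1296 * (Real.logb 2 (C / ε') ^ 2 / Real.logb 2 s ^ 2) := by
    intro ε' hε' hle hRε
    obtain ⟨m, V, hV, hm, g₁, hg₁, g₂, hg₂, hg⟩ := hR F C ε' hF hFC hC hε' hRε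
    obtain ⟨N, hN1, hN2, hN⟩ := hV.exists_network (𝕜 := 𝕜) hn M hg₁ hg₂
    refine ⟨N, fun x hx => ?_, hN1.trans hN2.symm, by rwa [hN2]⟩
    obtain ⟨hmem, hfx⟩ := hscale x hx
    obtain ⟨e₁, e₂⟩ := hg _ hmem
    rw [hfx] at e₁ e₂
    have hre : (RCLike.map 𝕜 ℂ (f x)).re = RCLike.re (f x) := by simp
    have him : (RCLike.map 𝕜 ℂ (f x)).im = RCLike.im (f x) := by simp
    rw [hre] at e₁
    rw [him] at e₂
    have e : N.eval (fun _ => x) - f x = ((g₁ (x / M) - RCLike.re (f x) : ℝ) : 𝕜)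
        + ((g₂ (x / M) - RCLike.im (f x) : ℝ) : 𝕜) * RCLike.I := by
      rw [hN]
      conv_lhs => rw [← RCLike.re_add_im (f x)]
      push_cast
      ring
    rw [e]
    refine (norm_add_le _ _).trans ?_
    rw [norm_mul, RCLike.norm_ofReal, RCLike.norm_ofReal]
    have hI : ‖(RCLike.I : 𝕜)‖ ≤ 1 := by
      rcases RCLike.I_eq_zero_or_im_I_eq_one (K := 𝕜) with h | h
      · simp [h]
      · exact (RCLike.norm_I_of_ne_zero (fun h0 => by simp [h0] at h)).le
    nlinarith [abs_nonneg (g₂ (x / M) - RCLike.im (f x))]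
  by_cases hbig : R ≤ C / ε
  · obtain ⟨N, hN, hNd, hNs⟩ := hnet ε hε le_rfl hbig
    have hK' : 1296 * (Real.logb 2 (C / ε) ^ 2 / Real.logb 2 s ^ 2)
        ≤ 1296 * (1 + Real.logb 2 R ^ 2 / l₁ ^ 2)
          * (Real.logb 2 (C / ε) ^ 2 / Real.logb 2 s ^ 2) := by
      refine mul_le_mul_of_nonneg_right ?_ hquot
      have : 0 ≤ Real.logb 2 R ^ 2 / l₁ ^ 2 := by positivity
      linarith
    exact ⟨N, hN, by rw [hNd]; exact hNs.trans hK', hNs.trans hK',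
      fun _ => ⟨by rw [hNd]; exact hNs, hNs⟩⟩
  by_cases hsmall : (1 - η) * C ≤ ε
  · -- `C / ε` may be so close to one that no unit is allowed: a constant has to do.
    have hCne : (C : ℂ) ≠ 0 := by exact_mod_cast hC.ne'
    obtain ⟨x₀, hx₀, t, ht⟩ := hη (fun z => F z / C) (fun z hz => (hF z hz).div_const)
      (fun z hz => by
        rw [norm_div, Complex.norm_real, Real.norm_eq_abs, abs_of_pos hC, div_le_one hC]
        exact hFC z hz)
    obtain ⟨N, hN1, hN2, hN⟩ := ReLUSpan.zero.exists_network (𝕜 := 𝕜) hn M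
      (ReLUSpan.zero.const_mem (RCLike.re ((t : 𝕜) * f (M * x₀))))
      (ReLUSpan.zero.const_mem (RCLike.im ((t : 𝕜) * f (M * x₀))))
    refine ⟨N, fun x hx => ?_, ?_, ?_, fun h => absurd h hbig⟩
    · obtain ⟨hmem, hfx⟩ := hscale x hx
      rw [hN, RCLike.re_add_im, norm_sub_rev]
      have h1 := ht _ hmem
      have e : F ((x / M : ℝ) : ℂ) / C - t * (F x₀ / C)
          = RCLike.map 𝕜 ℂ (f x - t • f (M * x₀)) / C := by
        rw [map_sub, map_smul, ← hfx, ← hFf _ hx₀, Complex.real_smul]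
        ring
      rw [e, norm_div, RCLike.norm_map_complex, Complex.norm_real, Real.norm_eq_abs,
        abs_of_pos hC, div_le_iff₀ hC, RCLike.real_smul_eq_coe_mul] at h1
      exact h1.trans hsmall
    · rw [hN1, Nat.cast_zero]
      positivity
    · rw [hN2, Nat.cast_zero]
      positivity
  · push Not at hbig hsmall
    have hRC : C / (C / R) = R := by field_simp
    obtain ⟨N, hN, hNd, hNs⟩ := hnet (C / R) (by positivity) (by
      rw [div_lt_iff₀ hε] at hbig
      rw [div_le_iff₀ (by linarith)]
      linarith) hRC.ge
    rw [hRC] at hNs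
    have hl : l₁ ≤ Real.logb 2 (C / ε) := by
      rw [hl₁]
      refine Real.logb_le_logb_of_le (by norm_num) (inv_pos.2 (by linarith)) ?_
      rw [inv_le_iff_one_le_mul₀ (by linarith), div_mul_eq_mul_div, one_le_div hε]
      linarith
    have hK' : 1296 * (Real.logb 2 R ^ 2 / Real.logb 2 s ^ 2)
        ≤ 1296 * (1 + Real.logb 2 R ^ 2 / l₁ ^ 2)
          * (Real.logb 2 (C / ε) ^ 2 / Real.logb 2 s ^ 2) := by
      have h1 : Real.logb 2 R ^ 2 ≤ Real.logb 2 R ^ 2 / l₁ ^ 2 * Real.logb 2 (C / ε) ^ 2 := by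
        rw [div_mul_eq_mul_div, le_div_iff₀ (by positivity)]
        gcongr
      calc 1296 * (Real.logb 2 R ^ 2 / Real.logb 2 s ^ 2)
          ≤ 1296 * ((Real.logb 2 R ^ 2 / l₁ ^ 2 * Real.logb 2 (C / ε) ^ 2)
              / Real.logb 2 s ^ 2) := by gcongr
        _ = 1296 * (Real.logb 2 R ^ 2 / l₁ ^ 2)
              * (Real.logb 2 (C / ε) ^ 2 / Real.logb 2 s ^ 2) := by ring
        _ ≤ _ := by
          refine mul_le_mul_of_nonneg_right ?_ hquot
          linarith
    exact ⟨N, hN, by rw [hNd]; exact hNs.trans hK', hNs.trans hK',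
      fun h => absurd h (not_le.2 hbig)⟩
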